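/- Let $d(j)$ denote the number of positive divisors of the positive integer $j$, and let $\gamma=0.57721\ldots$ be Euler's constant. For every real $q$ with $0<q<1$ the series $\sum_{k=1}^\infty\bigl(\sum_{j=1}^k d(j)\bigr)q^k$ converges, and $$\gamma\,\frac{q}{(1-q)^2}+\frac{\log(1-q)}{(1-q)\log q}<\sum_{k=1}^\infty\Bigl(\sum_{j=1}^k d(j)\Bigr)q^k<\frac{q}{(1-q)^2}+\frac{\log(1-q)}{(1-q)\log q}.$$ The constant factors are best possible: $\gamma$ is the largest real number $\lambda$ such that $$\lambda\,\frac{q}{(1-q)^2}+\frac{\log(1-q)}{(1-q)\log q}<\sum_{k=1}^\infty\Bigl(\sum_{j=1}^k d(j)\Bigr)q^k\quad\text{for all }0<q<1,$$ and $1$ is the smallest real number $\mu$ such that $$\sum_{k=1}^\infty\Bigl(\sum_{j=1}^k d(j)\Bigr)q^k<\mu\,\frac{q}{(1-q)^2}+\frac{\log(1-q)}{(1-q)\log q}\quad\text{for all }0<q<1.$$ -/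

import Mathlib

/-- The summatory divisor function `k ↦ d(1) + ⋯ + d(k)`, where `d(j)` is the number of
positive divisors of `j`. -/
def divisorSummatory (k : ℕ) : ℕ :=
  ∑ j ∈ Finset.Icc 1 k, j.divisors.card

/-- The power series `∑_{k ≥ 1} (d(1) + ⋯ + d(k)) q ^ k`; the index is shifted by one so that the
sum runs over `k = 1, 2, …`. -/
noncomputable def divisorSummatorySeries (q : ℝ) : ℝ :=
  ∑' k : ℕ, (divisorSummatory (k + 1) : ℝ) * q ^ (k + 1)

/-- The comparison function `c * q / (1 - q) ^ 2 + log (1 - q) / ((1 - q) * log q)`. -/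
noncomputable def divisorSummatoryBound (c q : ℝ) : ℝ :=
  c * (q / (1 - q) ^ 2) + Real.log (1 - q) / ((1 - q) * Real.log q)

open Filter Topology

/-! Put `q = exp (-t)`. Multiplying the series by `1 - q` gives the Lambert series of `q ^ k / (1 -
q ^ k)`. Splitting `1 / (1 - exp (-s))` at `s = k t` into `lambertKernel s + 1 / s`, the `1 / s`
part sums to the logarithmic term, so series minus bound is a positive factor times `lambertMean t -
c` (`divisorSummatorySeries_sub_bound`). It remains to see that `lambertMean` has infimum `γ` and
supremum `1`, neither attained. The kernel is below `1` and tends to `1`, which settles the top. At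
the bottom, halving `t` strictly lowers the mean, and the mean tends to `γ` as `t → 0+` by dominated
convergence (`tendsto_lambertMean_zero`). -/

/-! ### The kernel -/

/-- The function `1 / (1 - exp (-s)) - 1 / s`, which on `s > 0` increases from `1 / 2` to `1`. -/
noncomputable def lambertKernel (s : ℝ) : ℝ := 1 / (1 - Real.exp (-s)) - 1 / s

lemma one_sub_exp_neg_pos {s : ℝ} (hs : 0 < s) : 0 < 1 - Real.exp (-s) := by
  have : Real.exp (-s) < 1 := by simpa using hs
  linarith

lemma one_sub_exp_neg_lt {s : ℝ} (hs : 0 < s) : 1 - Real.exp (-s) < s := by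
  have := Real.add_one_lt_exp (x := -s) (by linarith)
  linarith

lemma mul_exp_neg_lt_one_sub_exp_neg {s : ℝ} (hs : 0 < s) :
    s * Real.exp (-s) < 1 - Real.exp (-s) := by
  have h1 := Real.add_one_lt_exp (x := s) (by linarith)
  have h2 : Real.exp s * Real.exp (-s) = 1 := by rw [← Real.exp_add]; simp
  nlinarith [Real.exp_pos (-s)]

/-- The square of `s / 2 < sinh (s / 2)` in disguise; it makes the derivative of the kernel
positive. -/
lemma sq_mul_exp_neg_lt {s : ℝ} (hs : 0 < s) :
    s ^ 2 * Real.exp (-s) < (1 - Real.exp (-s)) ^ 2 := by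
  have h1 : s / 2 < Real.sinh (s / 2) := Real.self_lt_sinh_iff.2 (by linarith)
  rw [Real.sinh_eq] at h1
  have h2 : Real.exp (s / 2) * Real.exp (-(s / 2)) = 1 := by rw [← Real.exp_add]; simp
  have h3 : Real.exp (-s) = Real.exp (-(s / 2)) ^ 2 := by
    rw [← Real.exp_nat_mul]; congr 1; push_cast; ring
  have h4 := Real.exp_pos (-(s / 2))
  have h5 : s * Real.exp (-(s / 2)) < 1 - Real.exp (-(s / 2)) ^ 2 := by nlinarith
  rw [h3, ← mul_pow]
  exact pow_lt_pow_left₀ h5 (by positivity) two_ne_zero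

lemma lambertKernel_pos {s : ℝ} (hs : 0 < s) : 0 < lambertKernel s :=
  sub_pos.2 (one_div_lt_one_div_of_lt (one_sub_exp_neg_pos hs) (one_sub_exp_neg_lt hs))

lemma lambertKernel_lt_one {s : ℝ} (hs : 0 < s) : lambertKernel s < 1 := by
  have h1 := one_sub_exp_neg_pos hs
  have h2 := mul_exp_neg_lt_one_sub_exp_neg hs
  rw [lambertKernel, sub_lt_iff_lt_add, div_lt_iff₀ h1]
  field_simp
  linarith

lemma lambertKernel_strictMonoOn : StrictMonoOn lambertKernel (Set.Ioi 0) := by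
  have hd : ∀ s ∈ Set.Ioi (0 : ℝ), HasDerivAt lambertKernel
      (-Real.exp (-s) / (1 - Real.exp (-s)) ^ 2 + 1 / s ^ 2) s := by
    intro s hs
    have h1 : HasDerivAt (fun x : ℝ => 1 - Real.exp (-x)) (Real.exp (-s)) s := by
      simpa using ((hasDerivAt_neg s).exp).const_sub 1
    have h2 := (h1.inv (one_sub_exp_neg_pos hs).ne').sub (hasDerivAt_inv (ne_of_gt hs))
    refine (h2.congr_deriv ?_).congr_of_eventuallyEq ?_
    · field_simp; ring
    · exact Eventually.of_forall fun x => by simp [lambertKernel]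
  refine strictMonoOn_of_deriv_pos (convex_Ioi 0)
    (fun s hs => (hd s hs).continuousAt.continuousWithinAt) fun s hs => ?_
  rw [interior_Ioi] at hs
  rw [(hd s hs).deriv, neg_div, neg_add_eq_sub, sub_pos]
  have hs' : 0 < s := hs
  rw [div_lt_div_iff₀ (pow_pos (one_sub_exp_neg_pos hs') 2) (by positivity)]
  linarith [sq_mul_exp_neg_lt hs']

lemma tendsto_lambertKernel_atTop : Tendsto lambertKernel atTop (𝓝 1) := by
  have h1 : Tendsto (fun s : ℝ => 1 - Real.exp (-s)) atTop (𝓝 (1 - 0)) :=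
    (Real.tendsto_exp_neg_atTop_nhds_zero).const_sub 1
  have h2 := (h1.inv₀ (by norm_num)).sub tendsto_inv_atTop_zero
  refine (h2.congr fun s => by simp [lambertKernel]).trans (by simp)

/-! ### The geometric mean of the kernel -/

/-- The mean of `lambertKernel` over the points `t, 2t, 3t, …` with geometric weights. -/
noncomputable def lambertMean (t : ℝ) : ℝ :=
  ∑' k : ℕ, (Real.exp (-(k * t)) - Real.exp (-((k + 1) * t))) * lambertKernel ((k + 1) * t)

lemma exp_neg_mul_sub_exp_neg_pos (k : ℕ) {t : ℝ} (ht : 0 < t) :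
    0 < Real.exp (-(k * t)) - Real.exp (-((k + 1) * t)) :=
  sub_pos.2 (Real.exp_lt_exp.2 (by linarith))

lemma exp_neg_natCast_mul (k : ℕ) (t : ℝ) : Real.exp (-(k * t)) = Real.exp (-t) ^ k := by
  rw [← Real.exp_nat_mul]; congr 1; ring

lemma exp_neg_succ_mul (k : ℕ) (t : ℝ) :
    Real.exp (-((k + 1) * t)) = Real.exp (-t) ^ (k + 1) := by
  exact_mod_cast exp_neg_natCast_mul (k + 1) t

lemma hasSum_exp_neg_mul_sub {t : ℝ} (ht : 0 < t) :
    HasSum (fun k : ℕ => Real.exp (-(k * t)) - Real.exp (-((k + 1) * t))) 1 := by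
  have h := (hasSum_geometric_of_lt_one (Real.exp_pos (-t)).le
    (by simpa using ht)).mul_right (1 - Real.exp (-t))
  rw [inv_mul_cancel₀ (one_sub_exp_neg_pos ht).ne'] at h
  refine h.congr_fun fun k => ?_
  rw [exp_neg_natCast_mul, exp_neg_succ_mul]; ring

lemma hasSum_lambertMean {t : ℝ} (ht : 0 < t) :
    HasSum (fun k : ℕ => (Real.exp (-(k * t)) - Real.exp (-((k + 1) * t))) *
      lambertKernel ((k + 1) * t)) (lambertMean t) := by
  refine (Summable.of_nonneg_of_le (fun k => ?_) (fun k => ?_)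
    (hasSum_exp_neg_mul_sub ht).summable).hasSum
  · exact mul_nonneg (exp_neg_mul_sub_exp_neg_pos k ht).le (lambertKernel_pos (by positivity)).le
  · exact mul_le_of_le_one_right (exp_neg_mul_sub_exp_neg_pos k ht).le
      (lambertKernel_lt_one (by positivity)).le

lemma lambertMean_lt_one {t : ℝ} (ht : 0 < t) : lambertMean t < 1 := by
  have h : ∀ k : ℕ, (Real.exp (-(k * t)) - Real.exp (-((k + 1) * t))) *
      lambertKernel ((k + 1) * t) < Real.exp (-(k * t)) - Real.exp (-((k + 1) * t)) := fun k =>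
    mul_lt_of_lt_one_right (exp_neg_mul_sub_exp_neg_pos k ht)
      (lambertKernel_lt_one (by positivity))
  exact hasSum_lt (fun k => (h k).le) (h 0) (hasSum_lambertMean ht) (hasSum_exp_neg_mul_sub ht)

lemma lambertKernel_le_lambertMean {t : ℝ} (ht : 0 < t) : lambertKernel t ≤ lambertMean t := by
  have h := (hasSum_exp_neg_mul_sub ht).mul_right (lambertKernel t)
  rw [one_mul] at h
  refine hasSum_le (fun k => ?_) h (hasSum_lambertMean ht)
  refine mul_le_mul_of_nonneg_left (lambertKernel_strictMonoOn.monotoneOn ht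
    (Set.mem_Ioi.2 (by positivity)) ?_) (exp_neg_mul_sub_exp_neg_pos k ht).le
  nlinarith [k.cast_nonneg (α := ℝ)]

lemma tendsto_lambertMean_atTop : Tendsto lambertMean atTop (𝓝 1) :=
  tendsto_of_tendsto_of_tendsto_of_le_of_le' tendsto_lambertKernel_atTop tendsto_const_nhds
    ((eventually_gt_atTop 0).mono fun _ ht => lambertKernel_le_lambertMean ht)
    ((eventually_gt_atTop 0).mono fun _ ht => (lambertMean_lt_one ht).le)

/-- Halving the step refines the geometric mean and decreases it. -/
lemma lambertMean_half_lt {t : ℝ} (ht : 0 < t) : lambertMean (t / 2) < lambertMean t := by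
  have hs := (hasSum_lambertMean (half_pos ht))
  have he := hs.summable.comp_injective (i := fun k : ℕ => 2 * k) fun a b h => by
    simpa using h
  have ho := hs.summable.comp_injective (i := fun k : ℕ => 2 * k + 1) fun a b h => by
    simpa using h
  have hsum := he.hasSum.add ho.hasSum
  have heq := hs.unique (he.hasSum.even_add_odd ho.hasSum)
  rw [← heq] at hsum
  have key : ∀ k : ℕ, _ < _ := fun k => show
    (Real.exp (-((2 * k : ℕ) * (t / 2))) - Real.exp (-(((2 * k : ℕ) + 1) * (t / 2)))) *
      lambertKernel (((2 * k : ℕ) + 1) * (t / 2)) +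
    (Real.exp (-((2 * k + 1 : ℕ) * (t / 2))) - Real.exp (-(((2 * k + 1 : ℕ) + 1) * (t / 2)))) *
      lambertKernel (((2 * k + 1 : ℕ) + 1) * (t / 2)) <
    (Real.exp (-(k * t)) - Real.exp (-((k + 1) * t))) * lambertKernel ((k + 1) * t) by
    have h1 := exp_neg_mul_sub_exp_neg_pos (2 * k) (half_pos ht)
    -- Only the even-indexed term drops: the odd one already samples the kernel at `(k + 1) * t`.
    have h2 : lambertKernel (((2 * k : ℕ) + 1) * (t / 2)) < lambertKernel ((k + 1) * t) :=
      lambertKernel_strictMonoOn (Set.mem_Ioi.2 (by positivity)) (Set.mem_Ioi.2 (by positivity))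
        (by push_cast; nlinarith)
    have e1 : ((2 * k : ℕ) : ℝ) * (t / 2) = k * t := by push_cast; ring
    have e2 : ((2 * k + 1 : ℕ) : ℝ) = ((2 * k : ℕ) : ℝ) + 1 := by push_cast; ring
    have e3 : (((2 * k : ℕ) : ℝ) + 1 + 1) * (t / 2) = (k + 1) * t := by push_cast; ring
    rw [e2, e3]
    rw [e1] at h1 ⊢
    linarith [mul_lt_mul_of_pos_left h2 h1]
  exact hasSum_lt (fun k => (key k).le) (key 0) hsum (hasSum_lambertMean ht)

/-! ### Reduction of the theorem to the mean -/

lemma hasSum_lambert {t : ℝ} (ht : 0 < t) :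
    HasSum (fun k : ℕ => Real.exp (-t) ^ (k + 1) / (1 - Real.exp (-t) ^ (k + 1)))
      (Real.exp (-t) / (1 - Real.exp (-t)) * lambertMean t - Real.log (1 - Real.exp (-t)) / t) := by
  have hq0 := Real.exp_pos (-t)
  have hq1 := one_sub_exp_neg_pos ht
  have hlog := (Real.hasSum_pow_div_log_of_abs_lt_one (x := Real.exp (-t))
    (by rw [abs_of_pos hq0]; linarith)).div_const t
  have h := ((hasSum_lambertMean ht).mul_left (Real.exp (-t) / (1 - Real.exp (-t)))).add hlog
  rw [neg_div, ← sub_eq_add_neg] at h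
  refine h.congr_fun fun k => ?_
  have hk := one_sub_exp_neg_pos (s := (k + 1) * t) (by positivity)
  rw [exp_neg_succ_mul] at hk
  rw [lambertKernel, exp_neg_natCast_mul, exp_neg_succ_mul]
  have hk' : ((k : ℝ) + 1) ≠ 0 := by positivity
  field_simp
  ring

lemma summable_divisorSummatory {q : ℝ} (h0 : 0 < q) (h1 : q < 1) :
    Summable fun k : ℕ => (divisorSummatory k : ℝ) * q ^ k := by
  refine Summable.of_nonneg_of_le (fun k => by positivity) (fun k => ?_)
    (summable_pow_mul_geometric_of_norm_lt_one 2 (r := q)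
      (by rwa [Real.norm_of_nonneg h0.le]))
  gcongr
  have : divisorSummatory k ≤ k ^ 2 := by
    calc divisorSummatory k ≤ ∑ j ∈ Finset.Icc 1 k, k := Finset.sum_le_sum fun j hj =>
          (Nat.card_divisors_le_self j).trans (Finset.mem_Icc.1 hj).2
      _ = k ^ 2 := by simp [sq]
  exact_mod_cast this

lemma divisorSummatory_succ (k : ℕ) :
    divisorSummatory (k + 1) = divisorSummatory k + (k + 1).divisors.card := by
  rw [divisorSummatory, Finset.sum_Icc_succ_top (by omega), divisorSummatory]

lemma tsum_card_divisors_mul_pow {q : ℝ} (h0 : 0 < q) (h1 : q < 1) :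
    ∑' k : ℕ, ((k + 1).divisors.card : ℝ) * q ^ (k + 1) =
      ∑' k : ℕ, q ^ (k + 1) / (1 - q ^ (k + 1)) := by
  have h := tsum_pow_div_one_sub_eq_tsum_sigma (r := q)
    (by rwa [Real.norm_of_nonneg h0.le]) 0
  rw [tsum_pnat_eq_tsum_succ (f := fun n : ℕ => (n : ℝ) ^ 0 * q ^ n / (1 - q ^ n)),
    tsum_pnat_eq_tsum_succ
      (f := fun n : ℕ => ((ArithmeticFunction.sigma 0 n : ℕ) : ℝ) * q ^ n)] at h
  simpa [ArithmeticFunction.sigma_zero_apply] using h.symm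

lemma one_sub_mul_divisorSummatorySeries {q : ℝ} (h0 : 0 < q) (h1 : q < 1) :
    (1 - q) * divisorSummatorySeries q = ∑' k : ℕ, q ^ (k + 1) / (1 - q ^ (k + 1)) := by
  have hs := summable_divisorSummatory h0 h1
  have hs' := (summable_nat_add_iff 1).2 hs
  have hz : divisorSummatorySeries q = ∑' k : ℕ, (divisorSummatory k : ℝ) * q ^ k := by
    rw [hs.tsum_eq_zero_add, divisorSummatorySeries]
    simp [divisorSummatory]
  rw [← tsum_card_divisors_mul_pow h0 h1, sub_mul, one_mul]
  nth_rewrite 2 [hz]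
  rw [divisorSummatorySeries, ← tsum_mul_left, ← hs'.tsum_sub (hs.mul_left q)]
  refine tsum_congr fun k => ?_
  rw [divisorSummatory_succ]
  push_cast
  ring

lemma divisorSummatorySeries_sub_bound {t : ℝ} (ht : 0 < t) (c : ℝ) :
    divisorSummatorySeries (Real.exp (-t)) - divisorSummatoryBound c (Real.exp (-t)) =
      Real.exp (-t) / (1 - Real.exp (-t)) ^ 2 * (lambertMean t - c) := by
  have hq1 := one_sub_exp_neg_pos ht
  have h := one_sub_mul_divisorSummatorySeries (Real.exp_pos (-t)) (by linarith)
  rw [(hasSum_lambert ht).tsum_eq] at h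
  have h2 := eq_div_of_mul_eq hq1.ne' ((mul_comm _ _).trans h)
  rw [h2, divisorSummatoryBound, Real.log_exp]
  field_simp
  ring

lemma divisorSummatoryBound_lt_iff {t : ℝ} (ht : 0 < t) (c : ℝ) :
    divisorSummatoryBound c (Real.exp (-t)) < divisorSummatorySeries (Real.exp (-t)) ↔
      c < lambertMean t := by
  rw [← sub_pos, divisorSummatorySeries_sub_bound ht, mul_pos_iff_of_pos_left
    (div_pos (Real.exp_pos _) (pow_pos (one_sub_exp_neg_pos ht) 2)), sub_pos]

lemma lt_divisorSummatoryBound_iff {t : ℝ} (ht : 0 < t) (c : ℝ) :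
    divisorSummatorySeries (Real.exp (-t)) < divisorSummatoryBound c (Real.exp (-t)) ↔
      lambertMean t < c := by
  rw [← sub_neg, divisorSummatorySeries_sub_bound ht, ← neg_pos, ← mul_neg,
    mul_pos_iff_of_pos_left (div_pos (Real.exp_pos _) (pow_pos (one_sub_exp_neg_pos ht) 2)),
    neg_sub, sub_pos]

lemma forall_pos_lt_one_iff (P : ℝ → Prop) :
    (∀ q : ℝ, 0 < q → q < 1 → P q) ↔ ∀ t : ℝ, 0 < t → P (Real.exp (-t)) := by
  refine ⟨fun h t ht => h _ (Real.exp_pos _) (by simpa using ht), fun h q h0 h1 => ?_⟩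
  have := h (-Real.log q) (neg_pos.2 (Real.log_neg h0 h1))
  rwa [neg_neg, Real.exp_log h0] at this

/-! ### The limit of the mean at zero -/

lemma hasSum_eulerMascheroniConstant :
    HasSum (fun n : ℕ => 1 / ((n : ℝ) + 1) - Real.log (((n : ℝ) + 2) / (n + 1)))
      Real.eulerMascheroniConstant := by
  rw [hasSum_iff_tendsto_nat_of_nonneg]
  · refine Real.tendsto_eulerMascheroniSeq.congr fun N => ?_
    induction N with
    | zero => simp [Real.eulerMascheroniSeq_zero]
    | succ N ih =>
      rw [Finset.sum_range_succ, ← ih, Real.eulerMascheroniSeq, Real.eulerMascheroniSeq,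
        harmonic_succ, Real.log_div (by positivity) (by positivity)]
      push_cast
      rw [add_assoc (N : ℝ) 1 1, one_add_one_eq_two]
      ring
  · intro n
    have := Real.log_le_sub_one_of_pos (x := ((n : ℝ) + 2) / (n + 1)) (by positivity)
    have h : ((n : ℝ) + 2) / (n + 1) - 1 = 1 / (n + 1) := by field_simp; ring
    linarith

/-- Telescopes. Subtracting it from `t` times the Lambert series cancels the logarithm there and
leaves only the mean. -/
lemma hasSum_log_one_sub_exp_neg {t : ℝ} (ht : 0 < t) :
    HasSum (fun n : ℕ => Real.log ((1 - Real.exp (-((n + 2) * t))) /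
      (1 - Real.exp (-((n + 1) * t))))) (-Real.log (1 - Real.exp (-t))) := by
  have hpos : ∀ n : ℕ, 0 < 1 - Real.exp (-((n + 1) * t)) := fun n =>
    one_sub_exp_neg_pos (by positivity)
  have hpos' : ∀ n : ℕ, 0 < 1 - Real.exp (-((n + 2) * t)) := fun n =>
    one_sub_exp_neg_pos (by positivity)
  rw [hasSum_iff_tendsto_nat_of_nonneg]
  · have hlim : Tendsto (fun N : ℕ => Real.log (1 - Real.exp (-((N + 1) * t)))) atTop (𝓝 0) := by
      have h1 : Tendsto (fun N : ℕ => ((N : ℝ) + 1) * t) atTop atTop :=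
        (tendsto_atTop_add_const_right _ 1 tendsto_natCast_atTop_atTop).atTop_mul_const ht
      have h2 := ((Real.tendsto_exp_neg_atTop_nhds_zero.comp h1).const_sub 1).log (by norm_num)
      simpa [Function.comp_def] using h2
    have h3 := hlim.sub_const (Real.log (1 - Real.exp (-t)))
    rw [zero_sub] at h3
    refine h3.congr fun N => ?_
    have h4 := Finset.sum_range_sub (fun n : ℕ => Real.log (1 - Real.exp (-((n + 1) * t)))) N
    simp only [Nat.cast_zero, zero_add, one_mul] at h4
    rw [← h4]
    refine Finset.sum_congr rfl fun n _ => ?_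
    rw [Real.log_div (hpos' n).ne' (hpos n).ne']
    push_cast
    rw [add_assoc (n : ℝ) 1 1, one_add_one_eq_two]
  · intro n
    refine Real.log_nonneg ((one_le_div (hpos n)).2 ?_)
    have : Real.exp (-((n + 2) * t)) ≤ Real.exp (-((n + 1) * t)) :=
      Real.exp_le_exp.2 (by nlinarith)
    linarith

/-- The difference between `t / (exp ((n + 1) t) - 1)` and its integral over a unit interval
starting at `n + 1`. -/
noncomputable def lambertGap (t : ℝ) (n : ℕ) : ℝ :=
  t * (Real.exp (-((n + 1) * t)) / (1 - Real.exp (-((n + 1) * t)))) -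
    Real.log ((1 - Real.exp (-((n + 2) * t))) / (1 - Real.exp (-((n + 1) * t))))

lemma hasSum_lambertGap {t : ℝ} (ht : 0 < t) :
    HasSum (lambertGap t) (t * (Real.exp (-t) / (1 - Real.exp (-t))) * lambertMean t) := by
  have h := ((hasSum_lambert ht).mul_left t).sub (hasSum_log_one_sub_exp_neg ht)
  have e : t * (Real.exp (-t) / (1 - Real.exp (-t)) * lambertMean t -
      Real.log (1 - Real.exp (-t)) / t) - -Real.log (1 - Real.exp (-t)) =
      t * (Real.exp (-t) / (1 - Real.exp (-t))) * lambertMean t := by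
    field_simp; ring
  rw [e] at h
  exact h.congr_fun fun n => by rw [lambertGap, exp_neg_succ_mul]

lemma lambertKernel_eq {s : ℝ} (hs : 0 < s) :
    Real.exp (-s) / (1 - Real.exp (-s)) = lambertKernel s + 1 / s - 1 := by
  have := (one_sub_exp_neg_pos hs).ne'
  rw [lambertKernel]; field_simp; ring

/-- A bound free of `t`, as domination requires. The integrand decreases, so the gap is at most its
drop over the interval; as the kernel increases, that drop is at most the drop of `1 / x`. -/
lemma lambertGap_mem_Icc {t : ℝ} (ht : 0 < t) (n : ℕ) :
    0 ≤ lambertGap t n ∧ lambertGap t n ≤ 1 / ((n : ℝ) + 1) - 1 / (n + 2) := by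
  have ha : (0 : ℝ) < (n + 1) * t := by positivity
  have hb : (0 : ℝ) < (n + 2) * t := by positivity
  have hA := one_sub_exp_neg_pos ha
  have hB := one_sub_exp_neg_pos hb
  have hr := div_pos hB hA
  have e : Real.exp (-((n + 2) * t)) = Real.exp (-((n + 1) * t)) * Real.exp (-t) := by
    rw [← Real.exp_add]; congr 1; ring
  have hup := Real.log_le_sub_one_of_pos hr
  have hlo := Real.one_sub_inv_le_log_of_pos hr
  rw [inv_div] at hlo
  have h1 : t * Real.exp (-((n + 2) * t)) / (1 - Real.exp (-((n + 2) * t))) ≤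
      1 - (1 - Real.exp (-((n + 1) * t))) / (1 - Real.exp (-((n + 2) * t))) := by
    rw [one_sub_div hB.ne']
    gcongr
    rw [e]
    nlinarith [mul_exp_neg_lt_one_sub_exp_neg ht, Real.exp_pos (-((n + 1) * t))]
  have h2 : (1 - Real.exp (-((n + 2) * t))) / (1 - Real.exp (-((n + 1) * t))) - 1 ≤
      t * Real.exp (-((n + 1) * t)) / (1 - Real.exp (-((n + 1) * t))) := by
    rw [div_sub_one hA.ne']
    gcongr
    rw [e]
    nlinarith [one_sub_exp_neg_lt ht, Real.exp_pos (-((n + 1) * t))]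
  rw [mul_div_assoc] at h1 h2
  refine ⟨by rw [lambertGap]; linarith, ?_⟩
  have hK := (lambertKernel_strictMonoOn (Set.mem_Ioi.2 ha) (Set.mem_Ioi.2 hb)
    (by nlinarith)).le
  have h3 : lambertGap t n ≤ t * (lambertKernel ((n + 1) * t) + 1 / ((n + 1) * t) - 1) -
      t * (lambertKernel ((n + 2) * t) + 1 / ((n + 2) * t) - 1) := by
    rw [← lambertKernel_eq ha, ← lambertKernel_eq hb, lambertGap]
    linarith
  have h4 : t * (1 / (((n : ℝ) + 1) * t)) = 1 / (n + 1) := by field_simp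
  have h5 : t * (1 / (((n : ℝ) + 2) * t)) = 1 / (n + 2) := by field_simp
  nlinarith [mul_le_mul_of_nonneg_left hK ht.le]

lemma tendsto_one_sub_exp_neg_div {a : ℝ} :
    Tendsto (fun t : ℝ => (1 - Real.exp (-(a * t))) / t) (𝓝[>] 0) (𝓝 a) := by
  have h : HasDerivAt (fun t : ℝ => 1 - Real.exp (-(a * t))) a 0 := by
    simpa using (((hasDerivAt_id (0 : ℝ)).const_mul a).neg.exp).const_sub 1
  simpa [div_eq_inv_mul] using h.tendsto_slope_zero_right

lemma tendsto_exp_neg_mul {a : ℝ} :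
    Tendsto (fun t : ℝ => Real.exp (-(a * t))) (𝓝[>] 0) (𝓝 1) := by
  have h : Continuous fun t : ℝ => Real.exp (-(a * t)) := by fun_prop
  simpa using (h.tendsto 0).mono_left nhdsWithin_le_nhds

lemma tendsto_lambertGap (n : ℕ) :
    Tendsto (lambertGap · n) (𝓝[>] 0)
      (𝓝 (1 / ((n : ℝ) + 1) - Real.log (((n : ℝ) + 2) / (n + 1)))) := by
  have h1 := tendsto_one_sub_exp_neg_div (a := n + 1)
  have h2 := tendsto_one_sub_exp_neg_div (a := n + 2)
  have hn : ((n : ℝ) + 1) ≠ 0 := by positivity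
  have hn2 : ((n : ℝ) + 2) / (n + 1) ≠ 0 := by positivity
  refine (((tendsto_exp_neg_mul (a := n + 1)).div h1 hn).sub ((h2.div h1 hn).log hn2)).congr' ?_
  filter_upwards [self_mem_nhdsWithin] with t ht
  have ht' : t ≠ 0 := ne_of_gt ht
  simp only [Pi.div_apply, lambertGap]
  rw [div_div_div_cancel_right₀ ht', div_div_eq_mul_div]
  ring

lemma summable_one_div_succ_sub :
    Summable fun n : ℕ => 1 / ((n : ℝ) + 1) - 1 / (n + 2) := by
  refine summable_of_sum_range_le (c := 1) (fun n => ?_) fun N => ?_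
  · exact sub_nonneg.2 (one_div_le_one_div_of_le (by positivity) (by linarith))
  · have h := Finset.sum_range_sub' (fun n : ℕ => 1 / ((n : ℝ) + 1)) N
    push_cast at h
    simp only [add_assoc, one_add_one_eq_two] at h ⊢
    rw [h]
    have : (0 : ℝ) ≤ 1 / (N + 1) := by positivity
    norm_num at this ⊢
    exact this

lemma tendsto_lambertMean_zero :
    Tendsto lambertMean (𝓝[>] 0) (𝓝 Real.eulerMascheroniConstant) := by
  have h := tendsto_tsum_of_dominated_convergence (f := fun t n => lambertGap t n)
    (𝓕 := 𝓝[>] 0) summable_one_div_succ_sub tendsto_lambertGap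
    (by
      filter_upwards [self_mem_nhdsWithin] with t ht n
      obtain ⟨h0, h1⟩ := lambertGap_mem_Icc ht n
      rwa [Real.norm_of_nonneg h0])
  rw [hasSum_eulerMascheroniConstant.tsum_eq] at h
  have h1 := (tendsto_one_sub_exp_neg_div (a := 1)).div (tendsto_exp_neg_mul (a := 1)) one_ne_zero
  have h2 := h1.mul h
  rw [div_one, one_mul] at h2
  refine h2.congr' ?_
  filter_upwards [self_mem_nhdsWithin] with t ht
  have ht' : t ≠ 0 := ne_of_gt ht
  have := (one_sub_exp_neg_pos (Set.mem_Ioi.1 ht)).ne'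
  rw [(hasSum_lambertGap ht).tsum_eq]
  simp only [Pi.div_apply, one_mul]
  field_simp

lemma eulerMascheroniConstant_lt_lambertMean {t : ℝ} (ht : 0 < t) :
    Real.eulerMascheroniConstant < lambertMean t := by
  -- One halving is spent on strictness; the limit along `t / 2 / 2 ^ m` gives only `≤`.
  refine lt_of_le_of_lt ?_ (lambertMean_half_lt ht)
  have hpow : ∀ m : ℕ, 0 < t / 2 / 2 ^ m := fun m => by positivity
  have hanti : Antitone fun m : ℕ => lambertMean (t / 2 / 2 ^ m) :=
    antitone_nat_of_succ_le fun m => by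
      rw [pow_succ, ← div_div]
      exact (lambertMean_half_lt (hpow m)).le
  have hlim : Tendsto (fun m : ℕ => t / 2 / 2 ^ m) atTop (𝓝[>] 0) := by
    refine tendsto_nhdsWithin_iff.2 ⟨?_, Eventually.of_forall hpow⟩
    exact (tendsto_pow_atTop_atTop_of_one_lt one_lt_two).const_div_atTop _
  simpa using hanti.le_of_tendsto (tendsto_lambertMean_zero.comp hlim) 0

theorem theorem4p3 :
    (∀ q : ℝ, 0 < q → q < 1 →
      Summable (fun k : ℕ => (divisorSummatory (k + 1) : ℝ) * q ^ (k + 1)) ∧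
      divisorSummatoryBound Real.eulerMascheroniConstant q < divisorSummatorySeries q ∧
      divisorSummatorySeries q < divisorSummatoryBound 1 q) ∧
    IsGreatest
      {c : ℝ | ∀ q : ℝ, 0 < q → q < 1 → divisorSummatoryBound c q < divisorSummatorySeries q}
      Real.eulerMascheroniConstant ∧
    IsLeast
      {c : ℝ | ∀ q : ℝ, 0 < q → q < 1 → divisorSummatorySeries q < divisorSummatoryBound c q}
      1 := by
  have hlower : ∀ c : ℝ, (∀ q : ℝ, 0 < q → q < 1 →
      divisorSummatoryBound c q < divisorSummatorySeries q) ↔ ∀ t, 0 < t → c < lambertMean t :=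
    fun c => (forall_pos_lt_one_iff _).trans
      (forall₂_congr fun t ht => divisorSummatoryBound_lt_iff ht c)
  have hupper : ∀ c : ℝ, (∀ q : ℝ, 0 < q → q < 1 →
      divisorSummatorySeries q < divisorSummatoryBound c q) ↔ ∀ t, 0 < t → lambertMean t < c :=
    fun c => (forall_pos_lt_one_iff _).trans
      (forall₂_congr fun t ht => lt_divisorSummatoryBound_iff ht c)
  have hγ := (hlower _).2 fun t ht => eulerMascheroniConstant_lt_lambertMean ht
  have h1 := (hupper 1).2 fun t ht => lambertMean_lt_one ht
  refine ⟨fun q hq0 hq1 => ⟨(summable_nat_add_iff 1).2 (summable_divisorSummatory hq0 hq1),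
    hγ q hq0 hq1, h1 q hq0 hq1⟩, ⟨hγ, fun c hc => ?_⟩, ⟨h1, fun c hc => ?_⟩⟩
  · refine ge_of_tendsto tendsto_lambertMean_zero ?_
    filter_upwards [self_mem_nhdsWithin] with t ht using ((hlower c).1 hc t ht).le
  · refine le_of_tendsto tendsto_lambertMean_atTop ?_
    filter_upwards [eventually_gt_atTop 0] with t ht using ((hupper c).1 hc t ht).le
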